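/- Let $G$ be a group and let $X\subseteq G$ be a finite symmetric generating set ($X=X^{-1}$), equipped with a fixed total order. Words $w\in X^*$ are identified with the paths they label from $1$ in the Cayley graph $\Gamma=\Gamma(G,X)$ (edges from $g$ to $gx$ for $x\in X$), whose graph metric is denoted $\mathrm d$. Let $\ell(w)$ be the length of $w$, write $w=_G u$ if $w$ and $u$ represent the same element of $G$, and let $\le_{\mathsf{SL}}$ be the shortlex order on $X^*$: $w\le_{\mathsf{SL}}v$ if $\ell(w)<\ell(v)$, or $\ell(w)=\ell(v)$ and $w$ equals or lexicographically precedes $v$. Assume that $(G,X)$ is shortlex automatic, that is, the language $\mathcal L=\{w\in X^*\mid w\le_{\mathsf{SL}}v\ \text{for all } v\in X^*\text{ with } v=_G w\}$ is a geodesic automatic structure: $\mathcal L$ is regular, maps onto $G$, each $w\in\mathcal L$ labels a geodesic path in $\Gamma$, and there is a constant $M$ such that for all $w\in\mathcal L$ and $x\in X$ there is $u\in\mathcal L$ with $wx=_G u$ for which the paths labelled by $wx$ and $u$ synchronously $M$-fellow travel (at every time $t\in\mathbb N$ their positions are at distance at most $M$, where a path stays at its endpoint after it ends). Let $H\le G$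 be a subgroup with bounded projections in $\Gamma$, that is, there is a constant $M'$ such that for all $u,v\in G$ with $\mathrm d(u,v)=1$ the diameter of $\pi_H(u)\cup\pi_H(v)$ is at most $M'$, where $\pi_H(v)=\{h\in H\mid \mathrm d(v,h)=\mathrm d(v,H)\}$. Then the language of shortlex-least representatives of the left cosets of $H$, $$\mathsf{ShortLex}(G/H,X)=\{w\in X^*\mid w\le_{\mathsf{SL}}v\ \text{ for all } v\in X^*\text{ with } vH=wH\},$$ is regular. -/

import Mathlib

namespace SimpleGraph

/-- The closest point projection of the vertex `v` onto the vertex set `Z`: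
the vertices `z` of `Z` with `d(v, z) = d(v, Z) = inf {d(v, z') | z' ∈ Z}`. -/
def closestPointProj {V : Type*} (Γ : SimpleGraph V) (Z : Set V) (v : V) : Set V :=
  {z | z ∈ Z ∧ Γ.dist v z = sInf (Γ.dist v '' Z)}

/-- `Z` has `M`-bounded projections: for adjacent `u`, `v` the diameter of the union of
the projections of `u` and `v` onto `Z` is at most `M`. -/
def HasBoundedProjectionsWith {V : Type*} (Γ : SimpleGraph V) (Z : Set V) (M : ℕ) : Prop :=
  ∀ u v : V, Γ.dist u v = 1 →
    ∀ a ∈ Γ.closestPointProj Z u ∪ Γ.closestPointProj Z v,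
      ∀ b ∈ Γ.closestPointProj Z u ∪ Γ.closestPointProj Z v, Γ.dist a b ≤ M

/-- `Z` has bounded projections: it has `M`-bounded projections for some `M`. -/
def HasBoundedProjections {V : Type*} (Γ : SimpleGraph V) (Z : Set V) : Prop :=
  ∃ M : ℕ, Γ.HasBoundedProjectionsWith Z M

end SimpleGraph

namespace GroupWord

variable {G : Type*} [Group G] {X : Set G}

/-- The element of `G` represented by a word over `X`. -/
def eval (w : List X) : G := (w.map Subtype.val).prod

/-- The vertex at time `t` of the path in the Cayley graph that starts at `1` and is labelled
by `w`; the path stays at its endpoint from time `w.length` on. -/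
def vertexAt (w : List X) (t : ℕ) : G := eval (w.take t)

/-- The paths labelled by `w` and `u` synchronously `M`-fellow travel in the Cayley graph. -/
def FellowTravel (M : ℕ) (w u : List X) : Prop :=
  ∀ t : ℕ, (SimpleGraph.mulCayley X).dist (vertexAt w t) (vertexAt u t) ≤ M

/-- The word `w` labels a geodesic path in the Cayley graph. -/
def IsGeodesic (w : List X) : Prop :=
  w.length = (SimpleGraph.mulCayley X).dist 1 (eval w)

/-- `L` is a geodesic automatic structure for `(G, X)`. -/
structure IsGeodesicAutomaticStructure (L : Language X) : Prop where
  regular : L.IsRegular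
  surjective : ∀ g : G, ∃ w ∈ L, eval w = g
  geodesic : ∀ w ∈ L, IsGeodesic w
  fellow_travel : ∃ M : ℕ, ∀ w ∈ L, ∀ x : X, ∃ u ∈ L,
    eval (w ++ [x]) = eval u ∧ FellowTravel M (w ++ [x]) u

/-- The (non-strict) shortlex order on words induced by the order on `X`. -/
def ShortlexLE [LinearOrder X] (w v : List X) : Prop :=
  w = v ∨ List.Shortlex (· < ·) w v

variable (X)

/-- The language of shortlex-least representatives of the elements of `G`. -/
def shortLexElements [LinearOrder X] : Language X :=
  {w : List X | ∀ v : List X, eval v = eval w → ShortlexLE w v}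

/-- The language of shortlex-least representatives of the left cosets `gH`. -/
def shortLexCosets [LinearOrder X] (H : Subgroup G) : Language X :=
  {w : List X | ∀ v : List X, ((eval v : G) : G ⧸ H) = ((eval w : G) : G ⧸ H) → ShortlexLE w v}

/-- `(G, X)` is shortlex automatic. -/
def IsShortlexAutomatic [LinearOrder X] : Prop :=
  IsGeodesicAutomaticStructure (shortLexElements X)

end GroupWord

namespace NFA

variable {α σ : Type*}

/-- The words with a suffix accepted by a nondeterministic automaton with finitely many states
form a regular language. -/
theorem isRegular_exists_suffix [Finite σ] (M : NFA α σ) :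
    Language.IsRegular ({w | ∃ s, s <:+ w ∧ s ∈ M.acceptsFrom M.start} : Language α) := by
  have : Fintype (Set σ) := Fintype.ofFinite _
  refine Language.isRegular_iff.2 ?_
  let N : DFA α (Set σ) :=
    { step := fun S a => M.stepSet S a ∪ M.start
      start := M.start
      accept := {S | ∃ q ∈ M.accept, q ∈ S} }
  have key : ∀ w q, q ∈ N.eval w ↔ ∃ s, s <:+ w ∧ q ∈ M.evalFrom M.start s := by
    intro w
    induction w using List.reverseRecOn with
    | nil => intro q; simp [N]
    | append_singleton w a ih =>
      intro q
      rw [DFA.eval_append_singleton]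
      change q ∈ M.stepSet (N.eval w) a ∪ M.start ↔ _
      simp only [Set.mem_union, NFA.mem_stepSet, ih]
      constructor
      · rintro (⟨t, ⟨s, hs, ht⟩, hq⟩ | hq)
        · refine ⟨s ++ [a], List.suffix_concat_iff.2 (Or.inr ⟨s, by simp, hs⟩), ?_⟩
          rw [NFA.evalFrom_append, NFA.evalFrom_singleton, NFA.mem_stepSet]
          exact ⟨t, ht, hq⟩
        · exact ⟨[], List.nil_suffix, hq⟩
      · rintro ⟨s, hs, hq⟩
        rcases List.suffix_concat_iff.1 hs with rfl | ⟨t, ht, hs'⟩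
        · exact Or.inr hq
        · obtain rfl : s = t ++ [a] := by simpa using ht
          rw [NFA.evalFrom_append, NFA.evalFrom_singleton, NFA.mem_stepSet] at hq
          obtain ⟨r, hr, hq⟩ := hq
          exact Or.inl ⟨r, ⟨t, hs', hr⟩, hq⟩
  refine ⟨Set σ, this, N, ?_⟩
  ext w
  change (∃ q ∈ M.accept, q ∈ N.eval w) ↔ ∃ s, s <:+ w ∧ ∃ q ∈ M.accept, q ∈ M.evalFrom M.start s
  simp only [key]
  constructor
  · rintro ⟨q, hq, s, hs, h⟩
    exact ⟨s, hs, q, hq, h⟩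
  · rintro ⟨s, hs, q, hq, h⟩
    exact ⟨q, hq, s, hs, h⟩

end NFA

namespace GroupWord

section Order

variable {G : Type*} {X : Set G} [LinearOrder X]

theorem shortlexLE_trans {u v w : List X} (h : ShortlexLE u v) (h' : ShortlexLE v w) :
    ShortlexLE u w := by
  rcases h with rfl | h
  · exact h'
  rcases h' with rfl | h'
  · exact Or.inr h
  right
  rw [List.shortlex_def] at *
  rcases h with h | ⟨h, l⟩ <;> rcases h' with h' | ⟨h', l'⟩
  · left; omega
  · left; omega
  · left; omega
  · exact Or.inr ⟨h.trans h', List.lt_trans l l'⟩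

theorem shortlex_of_not_shortlexLE {v w : List X} (h : ¬ ShortlexLE w v) :
    List.Shortlex (· < ·) v w := by
  by_contra h'
  exact h (Or.inl (Std.Trichotomous.trichotomous (r := List.Shortlex (· < ·)) w v
    (fun h'' => h (Or.inr h'')) h'))

theorem not_shortlexLE_of_shortlex {v w : List X} (h : List.Shortlex (· < ·) v w) :
    ¬ ShortlexLE w v := by
  rintro (rfl | h')
  · exact Std.Asymm.asymm _ _ h h
  · exact Std.Asymm.asymm _ _ h h'

theorem ShortlexLE.length_le {v w : List X} (h : ShortlexLE v w) : v.length ≤ w.length := by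
  rcases h with rfl | h
  · rfl
  · rcases List.shortlex_def.1 h with h | h <;> omega

end Order

variable {G : Type*} [Group G] {X : Set G}

section Words

@[simp] theorem eval_nil : eval ([] : List X) = 1 := rfl

@[simp] theorem eval_cons (x : X) (w : List X) : eval (x :: w) = x * eval w := by
  simp [eval]

@[simp] theorem eval_append (v w : List X) : eval (v ++ w) = eval v * eval w := by
  simp [eval]

theorem exists_walk_length_le (g : G) (w : List X) :
    ∃ p : (SimpleGraph.mulCayley X).Walk g (g * eval w), p.length ≤ w.length := by
  induction w generalizing g with
  | nil => exact ⟨SimpleGraph.Walk.nil.copy rfl (by simp), by rw [SimpleGraph.Walk.length_copy]; simp⟩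
  | cons x w ih =>
    obtain ⟨p, hp⟩ := ih (g * x)
    have e : g * x * eval w = g * eval (x :: w) := by simp [mul_assoc]
    by_cases hx : (x : G) = 1
    · exact ⟨p.copy (by simp [hx]) e, by simp; omega⟩
    · have hadj : (SimpleGraph.mulCayley X).Adj g (g * x) := by
        rw [SimpleGraph.mulCayley_adj]
        exact ⟨by simpa using hx, Or.inl (by simp)⟩
      exact ⟨(SimpleGraph.Walk.cons hadj p).copy rfl e, by simpa using hp⟩

theorem dist_mul_eval_le (g : G) (w : List X) :
    (SimpleGraph.mulCayley X).dist g (g * eval w) ≤ w.length := by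
  obtain ⟨p, hp⟩ := exists_walk_length_le g w
  exact (SimpleGraph.dist_le p).trans hp

theorem exists_word_of_walk (hsymm : ∀ x ∈ X, x⁻¹ ∈ X) {g k : G}
    (p : (SimpleGraph.mulCayley X).Walk g k) :
    ∃ w : List X, w.length = p.length ∧ g * eval w = k := by
  induction p with
  | nil => exact ⟨[], by simp⟩
  | @cons a b c h p ih =>
    obtain ⟨w, hw, e⟩ := ih
    have hx : a⁻¹ * b ∈ X := by
      rcases ((SimpleGraph.mulCayley_adj X a b).1 h).2 with h | h
      · exact h
      · simpa using hsymm _ h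
    exact ⟨⟨_, hx⟩ :: w, by simp [hw], by simp [← e, mul_assoc]⟩

theorem connected_mulCayley (hsurj : ∀ g : G, ∃ w : List X, eval w = g) :
    (SimpleGraph.mulCayley X).Connected := by
  have : Nonempty G := ⟨1⟩
  refine ⟨fun g k => ?_⟩
  obtain ⟨w, hw⟩ := hsurj (g⁻¹ * k)
  obtain ⟨p, -⟩ := exists_walk_length_le g w
  exact ⟨p.copy rfl (by simp [hw])⟩

theorem exists_word_length_eq_dist (hsymm : ∀ x ∈ X, x⁻¹ ∈ X)
    (hsurj : ∀ g : G, ∃ w : List X, eval w = g) (g k : G) :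
    ∃ w : List X, w.length = (SimpleGraph.mulCayley X).dist g k ∧ g * eval w = k := by
  obtain ⟨p, hp⟩ := (connected_mulCayley hsurj).exists_walk_length_eq_dist g k
  rw [← hp]
  exact exists_word_of_walk hsymm p

theorem dist_one_inv_mul_le (hsymm : ∀ x ∈ X, x⁻¹ ∈ X)
    (hsurj : ∀ g : G, ∃ w : List X, eval w = g) (g k : G) :
    (SimpleGraph.mulCayley X).dist 1 (g⁻¹ * k) ≤ (SimpleGraph.mulCayley X).dist g k := by
  obtain ⟨w, hw, e⟩ := exists_word_length_eq_dist hsymm hsurj g k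
  rw [← hw, ← e]
  simpa using dist_mul_eval_le 1 w

theorem finite_ball (hfin : X.Finite) (hsymm : ∀ x ∈ X, x⁻¹ ∈ X)
    (hsurj : ∀ g : G, ∃ w : List X, eval w = g) (K : ℕ) :
    {g | (SimpleGraph.mulCayley X).dist 1 g ≤ K}.Finite := by
  have : Finite X := hfin
  refine ((List.finite_length_le X K).image eval).subset fun g hg => ?_
  obtain ⟨w, hw, e⟩ := exists_word_length_eq_dist hsymm hsurj 1 g
  exact ⟨w, by simpa [hw] using hg, by simpa using e⟩

theorem dist_vertexAt_append_singleton_le (w : List X) (x : X) (t : ℕ) :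
    (SimpleGraph.mulCayley X).dist (vertexAt w t) (vertexAt (w ++ [x]) t) ≤ 1 := by
  have e : vertexAt (w ++ [x]) t = vertexAt w t * eval ([x].take (t - w.length)) := by
    simp [vertexAt, List.take_append]
  rw [e]
  exact (dist_mul_eval_le _ _).trans (by simp)

theorem exists_fellowTravel_mul_eval {L : Language X} (hL : IsGeodesicAutomaticStructure L) :
    ∃ M : ℕ, ∀ w ∈ L, ∀ y : List X, ∃ u ∈ L, eval u = eval w * eval y ∧
      FellowTravel (y.length * (M + 1)) w u := by
  have hconn := connected_mulCayley fun g => (hL.surjective g).imp fun _ h => h.2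
  obtain ⟨M, hM⟩ := hL.fellow_travel
  refine ⟨M, fun w hw y => ?_⟩
  induction y using List.reverseRecOn with
  | nil => exact ⟨w, hw, by simp, fun t => by simp⟩
  | append_singleton y x ih =>
    obtain ⟨u, hu, e, hft⟩ := ih
    obtain ⟨v, hv, e', hft'⟩ := hM u hu x
    refine ⟨v, hv, by simp [← e', e, mul_assoc], fun t => ?_⟩
    have h1 := hconn.dist_triangle (u := vertexAt w t) (v := vertexAt u t) (w := vertexAt v t)
    have h2 := hconn.dist_triangle (u := vertexAt u t) (v := vertexAt (u ++ [x]) t)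
      (w := vertexAt v t)
    have h3 := dist_vertexAt_append_singleton_le u x t
    have h4 := hft t
    have h5 := hft' t
    rw [List.length_append, add_mul]
    simp only [List.length_singleton, one_mul]
    omega

theorem mem_closestPointProj_of_forall_length_le (hsymm : ∀ x ∈ X, x⁻¹ ∈ X)
    (hsurj : ∀ g : G, ∃ w : List X, eval w = g) (H : Subgroup G) (g : G) (v : List X)
    (hv : g⁻¹ * eval v ∈ H)
    (hmin : ∀ u : List X, g⁻¹ * eval u ∈ H → v.length ≤ u.length) :
    g⁻¹ * eval v ∈ (SimpleGraph.mulCayley X).closestPointProj (H : Set G) g⁻¹ := by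
  have hleast : IsLeast ((SimpleGraph.mulCayley X).dist g⁻¹ '' (H : Set G))
      ((SimpleGraph.mulCayley X).dist g⁻¹ (g⁻¹ * eval v)) := by
    refine ⟨⟨_, hv, rfl⟩, ?_⟩
    rintro _ ⟨k, hk, rfl⟩
    obtain ⟨u, hu, rfl⟩ := exists_word_length_eq_dist hsymm hsurj g⁻¹ k
    rw [← hu]
    exact (dist_mul_eval_le _ _).trans (hmin u hk)
  exact ⟨hv, hleast.csInf_eq.symm⟩

end Words

section ShortLexLanguages

variable [LinearOrder X]

theorem mem_shortLexElements_of_append {p s : List X} (h : p ++ s ∈ shortLexElements X) :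
    s ∈ shortLexElements X := by
  intro v hv
  by_contra hlt
  exact not_shortlexLE_of_shortlex ((shortlex_of_not_shortlexLE hlt).append_left p)
    (h (p ++ v) (by simp [hv]))

theorem shortLexCosets_le_shortLexElements (H : Subgroup G) :
    shortLexCosets X H ≤ shortLexElements X :=
  fun _ hw v hv => hw v (by rw [hv])

end ShortLexLanguages

section Automaton

variable [LinearOrder X]

/-- The group element of an optional letter; a missing letter stands for a pause. -/
def optionVal : Option X → G
  | none => 1
  | some x => x

/-- Updates the comparison of two words, the first of which may pause, by one more letter of each.
Once the first word pauses, it ends up shorter and hence smaller in the shortlex order. -/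
def updateOrdering (c : Ordering) (a : X) : Option X → Ordering
  | none => .lt
  | some b => c.then (compare b a)

/-- The nondeterministic automaton that reads a word `s` and guesses a word `v` which is smaller in
the shortlex order and represents an element of the same left coset of `H`, while the word
differences stay in `D`. -/
def cosetCompetitor (H : Subgroup G) (D : Set G) : NFA X (D × Ordering) where
  step q a := {r | ∃ b : Option X, (r.1 : G) = (a : G)⁻¹ * q.1 * optionVal b ∧
    r.2 = updateOrdering q.2 a b}
  start := {q | (q.1 : G) = 1 ∧ q.2 = .eq}
  accept := {q | (q.1 : G) ∈ H ∧ q.2 = .lt}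

variable {H : Subgroup G} {D : Set G}

theorem exists_word_of_mem_acceptsFrom (s : List X) (S : Set (D × Ordering))
    (h : s ∈ (cosetCompetitor H D).acceptsFrom S) :
    ∃ q ∈ S, ∃ v : List X, (eval s)⁻¹ * q.1 * eval v ∈ H ∧ (v.length < s.length ∨
      v.length = s.length ∧ (q.2 = .lt ∨ q.2 = .eq ∧ List.Lex (· < ·) v s)) := by
  induction s generalizing S with
  | nil =>
    obtain ⟨q, hq, hH, hlt⟩ := (NFA.nil_mem_acceptsFrom _).1 h
    exact ⟨q, hq, [], by simpa using hH, Or.inr ⟨rfl, Or.inl hlt⟩⟩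
  | cons a s ih =>
    obtain ⟨r, hr, v, hv, hc⟩ := ih _ ((NFA.cons_mem_acceptsFrom _).1 h)
    obtain ⟨q, hq, b, e, ec⟩ := NFA.mem_stepSet.1 hr
    refine ⟨q, hq, ?_⟩
    cases b with
    | none =>
      refine ⟨v, by simpa [e, optionVal, mul_assoc] using hv, Or.inl ?_⟩
      simp only [List.length_cons]
      omega
    | some b =>
      refine ⟨b :: v, by simpa [e, optionVal, mul_assoc] using hv, ?_⟩
      simp only [List.length_cons, add_lt_add_iff_right, add_left_inj]
      refine hc.imp_right (And.imp_right fun hc => ?_)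
      rw [ec] at hc
      cases hq2 : q.2 with
      | lt => simp
      | gt => simp [updateOrdering, hq2] at hc
      | eq =>
        right
        refine ⟨rfl, ?_⟩
        simp only [updateOrdering, hq2, Ordering.then, compare_lt_iff_lt, compare_eq_iff_eq] at hc
        rcases hc with hc | ⟨rfl, hc⟩
        · exact List.Lex.rel hc
        · exact List.Lex.cons hc

theorem mem_acceptsFrom_of_shortlex (s v : List X) (S : Set (D × Ordering)) (q : D × Ordering)
    (hq : q ∈ S)
    (hD : ∀ t, (eval (s.take t))⁻¹ * q.1 * eval (v.take t) ∈ D)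
    (hH : (eval s)⁻¹ * q.1 * eval v ∈ H)
    (hc : v.length < s.length ∨
      v.length = s.length ∧ (q.2 = .lt ∨ q.2 = .eq ∧ List.Lex (· < ·) v s)) :
    s ∈ (cosetCompetitor H D).acceptsFrom S := by
  induction s generalizing S q v with
  | nil =>
    obtain rfl : v = [] := by
      rw [← List.length_eq_zero_iff]
      simp only [List.length_nil] at hc
      omega
    rw [NFA.nil_mem_acceptsFrom]
    exact ⟨q, hq, by simpa using hH, by simpa using hc⟩
  | cons a s ih =>
    rw [NFA.cons_mem_acceptsFrom]
    cases v with
    | nil =>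
      have h1 : (a : G)⁻¹ * q.1 * optionVal (none : Option X) ∈ D := by
        simpa [optionVal] using hD 1
      refine ih [] _ (⟨_, h1⟩, .lt) (NFA.mem_stepSet.2 ⟨q, hq, none, rfl, rfl⟩) (fun t => ?_)
        ?_ ?_
      · simpa [optionVal, mul_assoc] using hD (t + 1)
      · simpa [optionVal, mul_assoc] using hH
      · simp only [true_or, and_true]
        simp only [List.length_cons, List.length_nil] at hc ⊢
        omega
    | cons b v =>
      have h1 : (a : G)⁻¹ * q.1 * optionVal (some b) ∈ D := by
        simpa [optionVal] using hD 1
      refine ih v _ (⟨_, h1⟩, updateOrdering q.2 a (some b))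
        (NFA.mem_stepSet.2 ⟨q, hq, some b, rfl, rfl⟩) (fun t => ?_) ?_ ?_
      · simpa [optionVal, mul_assoc] using hD (t + 1)
      · simpa [optionVal, mul_assoc] using hH
      · simp only [List.length_cons, add_lt_add_iff_right, add_left_inj] at hc
        refine hc.imp_right (And.imp_right fun hc => ?_)
        rcases hc with hc | ⟨hq2, hlex⟩
        · simp [updateOrdering, hc]
        · cases hlex with
          | rel h => simp [updateOrdering, hq2, Ordering.then, compare_lt_iff_lt.2 h]
          | cons h =>
            right
            rw [hq2]
            exact ⟨by simp [updateOrdering, Ordering.then], h⟩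

theorem not_mem_shortLexCosets_of_suffix {s w : List X} (hs : s <:+ w)
    (h : s ∈ (cosetCompetitor (X := X) H D).acceptsFrom (cosetCompetitor (X := X) H D).start) :
    w ∉ shortLexCosets X H := by
  obtain ⟨p, rfl⟩ := hs
  obtain ⟨q, ⟨hq1, hq2⟩, v, hv, hc⟩ := exists_word_of_mem_acceptsFrom s _ h
  intro hw
  have hlt : List.Shortlex (· < ·) v s := by
    rw [List.shortlex_def]
    simpa [hq2] using hc
  refine not_shortlexLE_of_shortlex (hlt.append_left p) (hw (p ++ v) ?_)
  rw [eq_comm, QuotientGroup.eq]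
  simpa [hq1, mul_assoc] using hv

end Automaton

section Cosets

variable [LinearOrder X]

theorem exists_bounded_competitor (hsymm : ∀ x ∈ X, x⁻¹ ∈ X)
    (hsurj : ∀ g : G, ∃ w : List X, eval w = g) {H : Subgroup G} {M : ℕ}
    (hM : (SimpleGraph.mulCayley X).HasBoundedProjectionsWith (H : Set G) M)
    {w : List X} (hw : w ∈ shortLexElements X) (hw' : w ∉ shortLexCosets X H) :
    ∃ s v : List X, s <:+ w ∧ List.Shortlex (· < ·) v s ∧ (eval s)⁻¹ * eval v ∈ H ∧
      (SimpleGraph.mulCayley X).dist 1 ((eval s)⁻¹ * eval v) ≤ M := by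
  induction w with
  | nil =>
    refine absurd (fun v _ => ?_) hw'
    rcases List.shortlex_nil_or_eq_nil (r := (· < ·)) v with h | rfl
    · exact Or.inr h
    · exact Or.inl rfl
  | cons x s ih =>
    have hs : s ∈ shortLexElements X := mem_shortLexElements_of_append (p := [x]) hw
    by_cases hs' : s ∈ shortLexCosets X H
    swap
    · obtain ⟨t, v, ht, h⟩ := ih hs hs'
      exact ⟨t, v, ht.trans (List.suffix_cons x s), h⟩
    obtain ⟨v₀, hv₀, hlt₀⟩ : ∃ v : List X, (eval (x :: s))⁻¹ * eval v ∈ H ∧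
        List.Shortlex (· < ·) v (x :: s) := by
      by_contra! hcon
      refine hw' fun v hv => ?_
      by_contra hlt
      exact hcon v (QuotientGroup.eq.1 hv.symm) (shortlex_of_not_shortlexLE hlt)
    obtain ⟨v, ⟨hv, hlt⟩, hmin⟩ := exists_minimalFor_of_wellFoundedLT
      (fun v : List X => (eval (x :: s))⁻¹ * eval v ∈ H ∧ List.Shortlex (· < ·) v (x :: s))
      List.length ⟨v₀, hv₀, hlt₀⟩
    refine ⟨x :: s, v, List.suffix_rfl, hlt, hv, ?_⟩
    have hvs : v.length ≤ (x :: s).length := ShortlexLE.length_le (Or.inr hlt)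
    have hproj := mem_closestPointProj_of_forall_length_le hsymm hsurj H _ v hv fun u hu => by
      by_contra! hul
      have := hmin ⟨hu, List.Shortlex.of_length_lt (hul.trans_le hvs)⟩ hul.le
      omega
    have hproj' := mem_closestPointProj_of_forall_length_le hsymm hsurj H (eval s) s (by simp)
      fun u hu => (hs' u (QuotientGroup.eq.2 hu).symm).length_le
    rw [inv_mul_cancel] at hproj'
    have hx : (x : G) ≠ 1 := fun hx => by
      have := (hw s (by simp [hx])).length_le
      simp at this
    have hadj : (SimpleGraph.mulCayley X).Adj (eval s)⁻¹ (eval (x :: s))⁻¹ := by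
      rw [SimpleGraph.mulCayley_adj]
      exact ⟨by simpa [eq_comm] using hx, Or.inr (by simp)⟩
    exact hM _ _ (SimpleGraph.dist_eq_one_iff_adj.2 hadj) _ (Or.inl hproj') _ (Or.inr hproj)

end Cosets

end GroupWord

open GroupWord in
theorem mainTheorem10 {G : Type*} [Group G] (X : Set G) (hfin : X.Finite)
    (hsymm : ∀ x ∈ X, x⁻¹ ∈ X) (hgen : Subgroup.closure X = ⊤) [LinearOrder X]
    (hauto : GroupWord.IsShortlexAutomatic X) (H : Subgroup G)
    (hproj : (SimpleGraph.mulCayley X).HasBoundedProjections (H : Set G)) :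
    (GroupWord.shortLexCosets X H).IsRegular := by
  have hsurj : ∀ g : G, ∃ w : List X, eval w = g :=
    fun g => (hauto.surjective g).imp fun _ h => h.2
  obtain ⟨M', hM'⟩ := hproj
  obtain ⟨M, hM⟩ := exists_fellowTravel_mul_eval hauto
  set D : Set G := {g | (SimpleGraph.mulCayley X).dist 1 g ≤ M' * (M + 1)} with hD
  have : Finite D := finite_ball hfin hsymm hsurj _
  have : Finite Ordering := Finite.of_surjective
    (fun b : Option Bool => b.elim Ordering.eq fun b => bif b then .lt else .gt)
    (fun c => by
      cases c
      exacts [⟨some true, rfl⟩, ⟨none, rfl⟩, ⟨some false, rfl⟩])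
  have hreg := hauto.regular.inf (cosetCompetitor H D).isRegular_exists_suffix.compl
  convert hreg using 1
  refine Set.Subset.antisymm (fun w hw => ⟨shortLexCosets_le_shortLexElements H hw, ?_⟩) ?_
  · rintro ⟨s, hs, h⟩
    exact not_mem_shortLexCosets_of_suffix hs h hw
  rintro w ⟨hw, hw'⟩
  by_contra hcos
  obtain ⟨s, v, hs, hlt, hv, hdist⟩ := exists_bounded_competitor hsymm hsurj hM' hw hcos
  refine hw' ⟨s, hs, ?_⟩
  obtain ⟨y, hy, e⟩ := exists_word_length_eq_dist hsymm hsurj 1 ((eval s)⁻¹ * eval v)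
  rw [one_mul] at e
  have hsL : s ∈ shortLexElements X := by
    obtain ⟨p, rfl⟩ := hs
    exact mem_shortLexElements_of_append hw
  obtain ⟨u, hu, eu, hft⟩ := hM s hsL y
  have euv : eval u = eval v := by simp [eu, e]
  have hus : List.Shortlex (· < ·) u s := shortlex_of_not_shortlexLE fun h =>
    not_shortlexLE_of_shortlex hlt (shortlexLE_trans h (hu v euv.symm))
  have hone : (1 : G) ∈ D := by simp [hD]
  refine mem_acceptsFrom_of_shortlex s u _ (⟨1, hone⟩, .eq) ⟨rfl, rfl⟩ (fun t => ?_) ?_ ?_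
  · rw [mul_one]
    refine ((dist_one_inv_mul_le hsymm hsurj _ _).trans (hft t)).trans ?_
    rw [hy]
    exact Nat.mul_le_mul_right _ hdist
  · simpa [euv] using hv
  · simpa [List.shortlex_def] using hus
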